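/- All logarithms are natural. For $p\in(0,1)$ let $\mathrm{Bin}_{x,p}$ be the binomial distribution with $x$ trials and success probability $p$, and $h(p)=-p\log p-(1-p)\log(1-p)$. The mean-limited binomial channel $\mathrm{Ch}_\mu(\mathrm{Ber}_p)$ takes a random non-negative integer $X$ and, given $X=x$, outputs a sample $Y_x$ of $\mathrm{Bin}_{x,p}$; its capacity $\mathrm{Cap}(\mathrm{Ch}_\mu(\mathrm{Ber}_p))$ is the supremum of the mutual information between input and output over all input distributions for which the output has mean $\mu$. For non-negative integers $x,y$ and $\varepsilon\in(0,1]$ put $$\mathcal E_\varepsilon(x)=\mathbb E\big[\log (Z!)\big],\ Z\sim\mathrm{Bin}_{x,\varepsilon},\qquad \Lambda_\varepsilon(y)=\int_0^1\frac{1-ty-(1-t)^y}{t\log(1-\varepsilon t)}\,dt,$$ and, for $0\le z<1$, $$\mathrm{Li}(z)=\int_0^z\frac{dt}{\log t},\qquad \eta(z)=\int_0^z\frac{dt}{(1-t)\log t}.$$ Let $g(0)=0$ and, for integers $y\ge 1$, $g(y)=g_p(y)$, where $$g_p(y)=\begin{cases}\Lambda_p(y)-\mathcal E_{1/p-1}(y)-\dfrac{y\,\mathrm{Li}(1-p)}{p}+\eta(1-p),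 & p\ge \tfrac12,\\[2mm] \Lambda_p(y)-\Lambda_{p/(1-p)}(y)+\dfrac yp\Big((1-p)\,\mathrm{Li}\big(\tfrac{1-2p}{1-p}\big)-\mathrm{Li}(1-p)\Big)+\displaystyle\int_p^{p/(1-p)}\frac{dt}{t\log(1-t)}, & p<\tfrac12.\end{cases}$$ For real $x\ge 0$ let $$R_p(x)=\int_p^1\frac{(1-t)^x-(1-p)^x}{t\log(1-t)}\,dt-\int_{p/(1-p)}^1\frac{(1-(1-p)t)^x-(1-p)^x}{t\log(1-t)}\,dt,$$ where the second integral is omitted if $p\ge\frac12$. **Theorem.** Let $p\in(0,1)$. Then $R_p(x)\ge 0$ for all $x\ge 0$, and $R_p$ decays exponentially: there are $C>0$ and $r\in(0,1)$, depending only on $p$, such that $R_p(x)\le C\,r^x$ for all $x\ge 0$. Moreover, for every $q\in(0,1)$ there is a normalizing constant $y_0\in(0,1)$ such that $$\Pr[Y=y]=y_0\,\frac{q^y\exp\big(g(y)-y\,h(p)/p\big)}{y!},\qquad y=0,1,2,\ldots,$$ defines a probability distribution. For a random variable $Y$ with this distribution: 1. for every integer $x\ge 0$ the Kullback–Leibler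 divergence of $Y_x\sim \mathrm{Bin}_{x,p}$ from $Y$ is finite and equals $$D(Y_x\,\|\,Y)=-xp\log q-\log y_0-R_p(x);$$ 2. the mean $\mu=\mathbb E[Y]$ is finite and positive, and $$\mathrm{Cap}(\mathrm{Ch}_\mu(\mathrm{Ber}_p))\le-\mu\log q-\log y_0 .$$ -/

import Mathlib

open MeasureTheory ProbabilityTheory InformationTheory
open scoped ENNReal NNReal

noncomputable section

namespace BinomialCapacity

/-! ### Mean-limited channels on the non-negative integers -/

/-- The mutual information `I(X; Y)` (in nats) between the input `X` of a channel with transition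
rule `W` and the corresponding output `Y`: the Kullback-Leibler divergence of the joint law of
`(X, Y)` from the product of the two marginal laws. -/
def mutualInfo (W : Kernel ℕ ℕ) (X : Measure ℕ) : ℝ≥0∞ :=
  klDiv (X ⊗ₘ W) (X.prod (W ∘ₘ X))

/-- The capacity of the mean-limited channel with transition rule `W`: the supremum of `I(X; Y)`
over all input distributions `X` whose output distribution `Y` has mean `μ`. -/
def meanLimitedCapacity (W : Kernel ℕ ℕ) (μ : ℝ≥0) : ℝ≥0∞ :=
  ⨆ (X : Measure ℕ) (_ : IsProbabilityMeasure X)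
    (_ : ∫⁻ y : ℕ, (y : ℝ≥0∞) ∂(W ∘ₘ X) = (μ : ℝ≥0∞)), mutualInfo W X

/-- The binomial channel: on input `x` it outputs a sample of the binomial law with `x` trials and
success probability `p`, i.e. a sum of `x` independent Bernoulli variables of mean `p`. -/
def binomialChannel (p : unitInterval) : Kernel ℕ ℕ :=
  Kernel.ofFunOfCountable fun x : ℕ => binomial x p

/-! ### The functions that enter the truncated distribution -/

/-- `𝓔_ε(x) = E[log (Z!)]` for `Z` binomial with `x` trials and success probability `ε`. -/
def expLogFactorial (ε : ℝ) (x : ℕ) : ℝ :=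
  ∑ k ∈ Finset.range (x + 1),
    (x.choose k : ℝ) * ε ^ k * (1 - ε) ^ (x - k) * Real.log (k.factorial : ℝ)

/-- The truncated log-gamma integral
`Λ_ε(y) = ∫₀¹ (1 - t y - (1 - t)^y) / (t log (1 - ε t)) dt`. -/
def truncLogGamma (ε : ℝ) (y : ℕ) : ℝ :=
  ∫ t in (0 : ℝ)..1, (1 - t * y - (1 - t) ^ y) / (t * Real.log (1 - ε * t))

/-- The logarithmic integral `Li(z) = ∫₀^z dt / log t`, used for `0 ≤ z < 1` only. -/
def logIntegral (z : ℝ) : ℝ :=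
  ∫ t in (0 : ℝ)..z, 1 / Real.log t

/-- `η(z) = ∫₀^z dt / ((1 - t) log t)`, used for `0 ≤ z < 1` only. -/
def etaIntegral (z : ℝ) : ℝ :=
  ∫ t in (0 : ℝ)..z, 1 / ((1 - t) * Real.log t)

/-- The function `g_p`. -/
def gFun (p : ℝ) (y : ℕ) : ℝ :=
  if p < 1 / 2 then
    truncLogGamma p y - truncLogGamma (p / (1 - p)) y
      + (y : ℝ) / p * ((1 - p) * logIntegral ((1 - 2 * p) / (1 - p)) - logIntegral (1 - p))
      + ∫ t in p..(p / (1 - p)), 1 / (t * Real.log (1 - t))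
  else
    truncLogGamma p y - expLogFactorial (1 / p - 1) y
      - (y : ℝ) * logIntegral (1 - p) / p + etaIntegral (1 - p)

/-- The function `g`, equal to `g_p` except that `g(0) = 0`. -/
def gTrunc (p : ℝ) (y : ℕ) : ℝ :=
  if y = 0 then 0 else gFun p y

/-- The mass function of the truncated distribution with normalizing constant `y₀`:
`y₀ q^y exp(g(y) - y h(p)/p) / y!`, where `h` is the binary entropy function in nats. -/
def truncMass (p q y₀ : ℝ) (y : ℕ) : ℝ :=
  y₀ * (q ^ y * Real.exp (gTrunc p y - (y : ℝ) * Real.binEntropy p / p) / (y.factorial : ℝ))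

/-- The gap `R_p(x)` for real `x ≥ 0`; the second integral is present only for `p < 1/2`. -/
def kktGap (p x : ℝ) : ℝ :=
  (∫ t in p..1, ((1 - t) ^ x - (1 - p) ^ x) / (t * Real.log (1 - t)))
    - if p < 1 / 2 then
        ∫ t in (p / (1 - p))..1,
          ((1 - (1 - p) * t) ^ x - (1 - p) ^ x) / (t * Real.log (1 - t))
      else 0

end BinomialCapacity

end

/-! The heart is one identity: for `Y_x` binomial, `E[g(Y_x)] = log x! - 𝓔_{1-p}(x) + R_p(x)`. Since
`-H(Y_x) = log x! - 𝓔_p(x) - 𝓔_{1-p}(x) - x h(p)`, all log-factorial terms cancel in `D(Y_x ‖ Y)`,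
which leaves a linear function of `x` minus `R_p(x)`.

The identity comes from integrals of `kernelJ b x`. Over `[0, 1]` they give `log x!` for `b = 1` and
`𝓔_b(x)` in general, and over `[0, ε]` the mean of `Λ_ε` under `Bin_{x,bε}`
(`binomExp_truncLogGamma`). Thus `Λ_p` reproduces `log x!` except for the part over `[p, 1]`. The
constant and linear pieces of that part are absorbed by `η` and `Li`; its power piece, with the
`(1-p)^x` caused by `g(0) = 0`, is `R_p`. The term `-𝓔_{1-p}(x)` is exact when `1/p - 1` is a
probability, and is truncated in the same way when `p < 1/2`.

For normalizability, `g(y) - log y! - y h(p)/p` is shown to be `c y + O(log y)`. The slope `c` is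
never computed: its binomial means are `R_p` plus a negative entropy, hence bounded above, which
forces `c ≤ 0` (`IsLinLog.nonpos_of_binomExp_le`). The weights are then at most polynomial times
`q^y`.

For the capacity, `I(X;Y)` is at most the `X`-average of `D(W_x ‖ Y)` for any fixed law `Y`;
dropping `R_p ≥ 0` leaves an average that depends on `X` only through the output mean. -/

namespace BinomialCapacity

/-! ### Expectations under binomial laws -/

/-- The expectation of `f` under the binomial law with `x` trials and success probability `a`. -/
noncomputable def binomExp (a : ℝ) (x : ℕ) (f : ℕ → ℝ) : ℝ :=
  ∑ k ∈ Finset.range (x + 1), (x.choose k : ℝ) * a ^ k * (1 - a) ^ (x - k) * f k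

lemma binomExp_zero (a : ℝ) (f : ℕ → ℝ) : binomExp a 0 f = f 0 := by
  simp [binomExp]

/-- Conditioning on one trial, i.e. Pascal's rule. It is an algebraic identity in `a`, and drives
the inductions below. -/
lemma binomExp_succ (a : ℝ) (x : ℕ) (f : ℕ → ℝ) :
    binomExp a (x + 1) f =
      a * binomExp a x (fun k => f (k + 1)) + (1 - a) * binomExp a x f := by
  have h2 : (1 - a) * binomExp a x f =
      ∑ k ∈ Finset.range (x + 1),
        (x.choose (k + 1) : ℝ) * a ^ (k + 1) * (1 - a) ^ (x - k) * f (k + 1)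
        + (1 - a) ^ (x + 1) * f 0 := by
    rw [binomExp, Finset.sum_range_succ', mul_add, Finset.mul_sum, Finset.sum_range_succ _ x]
    simp only [Nat.choose_succ_self, Nat.cast_zero, zero_mul, add_zero]
    congr 1
    · refine Finset.sum_congr rfl fun k hk => ?_
      obtain ⟨d, rfl⟩ : ∃ d, x = k + 1 + d := ⟨x - (k + 1), by have := Finset.mem_range.1 hk; omega⟩
      rw [show k + 1 + d - (k + 1) = d by omega, show k + 1 + d - k = d + 1 by omega]
      ring
    · simp; ring
  rw [h2, binomExp, binomExp, Finset.sum_range_succ', Finset.mul_sum, ← add_assoc,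
    ← Finset.sum_add_distrib]
  congr 1
  · refine Finset.sum_congr rfl fun k _ => ?_
    rw [Nat.choose_succ_succ, show x + 1 - (k + 1) = x - k by omega]
    push_cast
    ring
  · simp

lemma binomExp_add (a : ℝ) (x : ℕ) (f g : ℕ → ℝ) :
    binomExp a x (fun k => f k + g k) = binomExp a x f + binomExp a x g := by
  simp only [binomExp, mul_add, Finset.sum_add_distrib]

lemma binomExp_sub (a : ℝ) (x : ℕ) (f g : ℕ → ℝ) :
    binomExp a x (fun k => f k - g k) = binomExp a x f - binomExp a x g := by
  simp only [binomExp, mul_sub, Finset.sum_sub_distrib]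

lemma binomExp_const_mul (a : ℝ) (x : ℕ) (c : ℝ) (f : ℕ → ℝ) :
    binomExp a x (fun k => c * f k) = c * binomExp a x f := by
  simp only [binomExp, Finset.mul_sum]
  exact Finset.sum_congr rfl fun k _ => by ring

lemma binomExp_const (a : ℝ) (x : ℕ) (c : ℝ) : binomExp a x (fun _ => c) = c := by
  induction x with
  | zero => simp [binomExp_zero]
  | succ x ih => rw [binomExp_succ, ih]; ring

lemma binomExp_natCast (a : ℝ) (x : ℕ) : binomExp a x (fun k => (k : ℝ)) = a * x := by
  induction x with
  | zero => simp [binomExp_zero]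
  | succ x ih =>
    rw [binomExp_succ]
    simp only [Nat.cast_add, Nat.cast_one]
    rw [binomExp_add, ih, binomExp_const]; ring

lemma binomExp_pow (a c : ℝ) (x : ℕ) :
    binomExp a x (fun k => c ^ k) = (1 - a + a * c) ^ x := by
  induction x with
  | zero => simp [binomExp_zero]
  | succ x ih =>
    rw [binomExp_succ]
    simp only [pow_succ' c]
    rw [binomExp_const_mul, ih]; ring

/-- A binomial thinning of a binomial law is binomial. -/
lemma binomExp_binomExp (a b : ℝ) (x : ℕ) (f : ℕ → ℝ) :
    binomExp a x (fun y => binomExp b y f) = binomExp (a * b) x f := by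
  induction x generalizing f with
  | zero => simp [binomExp_zero]
  | succ x ih =>
    rw [binomExp_succ, binomExp_succ]
    simp only [binomExp_succ b]
    rw [binomExp_add, binomExp_const_mul, binomExp_const_mul, ih, ih]; ring

lemma binomExp_indicator_zero (a c : ℝ) (x : ℕ) :
    binomExp a x (fun k => if k = 0 then c else 0) = c * (1 - a) ^ x := by
  rw [binomExp, Finset.sum_eq_single 0] <;> simp +contextual [mul_comm]

lemma binomExp_flip (a : ℝ) (x : ℕ) (f : ℕ → ℝ) :
    binomExp a x (fun k => f (x - k)) = binomExp (1 - a) x f := by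
  rw [binomExp, binomExp, ← Finset.sum_flip]
  refine Finset.sum_congr rfl fun k hk => ?_
  have hk : k ≤ x := Nat.lt_succ_iff.1 (Finset.mem_range.1 hk)
  rw [Nat.choose_symm hk, Nat.sub_sub_self hk]
  ring

lemma binomExp_mono {a : ℝ} (h0 : 0 ≤ a) (h1 : a ≤ 1) {x : ℕ} {f g : ℕ → ℝ}
    (h : ∀ k ≤ x, f k ≤ g k) : binomExp a x f ≤ binomExp a x g := by
  refine Finset.sum_le_sum fun k hk => ?_
  have : 0 ≤ 1 - a := by linarith
  exact mul_le_mul_of_nonneg_left (h k (Nat.lt_succ_iff.1 (Finset.mem_range.1 hk)))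
    (by positivity)

/-- The mean of `1 / (Z + 1)` for a binomial variable `Z`. -/
lemma binomExp_inv_succ (a : ℝ) (x : ℕ) :
    a * (x + 1) * binomExp a x (fun k => 1 / ((k : ℝ) + 1)) = 1 - (1 - a) ^ (x + 1) := by
  have h := binomExp_const a (x + 1) 1
  rw [binomExp, Finset.sum_range_succ'] at h
  have h2 : a * (x + 1) * binomExp a x (fun k => 1 / ((k : ℝ) + 1)) =
      ∑ k ∈ Finset.range (x + 1),
        ((x + 1).choose (k + 1) : ℝ) * a ^ (k + 1) * (1 - a) ^ (x + 1 - (k + 1)) * 1 := by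
    rw [binomExp, Finset.mul_sum]
    refine Finset.sum_congr rfl fun k _ => ?_
    have h3 : ((x : ℝ) + 1) * x.choose k = (x + 1).choose (k + 1) * (k + 1) := by
      exact_mod_cast Nat.add_one_mul_choose_eq x k
    rw [Nat.add_sub_add_right]
    field_simp
    linear_combination a * (1 - a) ^ (x - k) * h3 * a ^ k
  rw [h2]
  simp at h ⊢
  linarith

/-! ### Integrals against `1 / (s log (1 - s))` -/

lemma le_neg_log_one_sub {s : ℝ} (h1 : s < 1) : s ≤ -Real.log (1 - s) := by
  have := Real.log_le_sub_one_of_pos (show 0 < 1 - s by linarith)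
  linarith

/-- Since `-log (1 - s) ≥ s`, the denominator is at least `s ^ 2` in absolute value, so a numerator
vanishing to second order removes the singularity at `0`. -/
lemma abs_div_mul_log_le {f s K : ℝ} (h0 : 0 < s) (h1 : s < 1) (hf : |f| ≤ K * s ^ 2) :
    |f / (s * Real.log (1 - s))| ≤ K := by
  have hl := le_neg_log_one_sub h1
  have hK : 0 ≤ K := nonneg_of_mul_nonneg_left ((abs_nonneg f).trans hf) (by positivity)
  have hlog : Real.log (1 - s) < 0 := by linarith
  rw [abs_div, abs_mul, abs_of_pos h0, abs_of_neg hlog, div_le_iff₀ (by nlinarith)]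
  calc |f| ≤ K * s ^ 2 := hf
    _ = K * (s * s) := by ring
    _ ≤ K * (s * -Real.log (1 - s)) := by gcongr

lemma intervalIntegrable_of_bounded {f : ℝ → ℝ} {a b K : ℝ} (hab : a ≤ b) (hf : Measurable f)
    (hK : ∀ s ∈ Set.Ioo a b, |f s| ≤ K) : IntervalIntegrable f volume a b := by
  rw [intervalIntegrable_iff_integrableOn_Ioo_of_le hab]
  refine Measure.integrableOn_of_bounded (M := K) (by simp) hf.aestronglyMeasurable ?_
  exact (ae_restrict_iff' measurableSet_Ioo).2 (Filter.Eventually.of_forall hK)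

lemma intervalIntegrable_div_mul_log {f : ℝ → ℝ} {a b K : ℝ} (ha : 0 ≤ a) (hab : a ≤ b)
    (hb : b ≤ 1) (hf : Measurable f) (hK : ∀ s ∈ Set.Ioo a b, |f s| ≤ K * s ^ 2) :
    IntervalIntegrable (fun s => f s / (s * Real.log (1 - s))) volume a b :=
  intervalIntegrable_of_bounded hab (by fun_prop) fun s hs =>
    abs_div_mul_log_le (ha.trans_lt hs.1) (hs.2.trans_le hb) (hK s hs)

/-- On an interval bounded away from `0` it suffices that the numerator is bounded. -/
lemma intervalIntegrable_div_mul_log' {f : ℝ → ℝ} {a b K : ℝ} (ha : 0 < a) (hab : a ≤ b)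
    (hb : b ≤ 1) (hf : Measurable f) (hK : ∀ s ∈ Set.Ioo a b, |f s| ≤ K) :
    IntervalIntegrable (fun s => f s / (s * Real.log (1 - s))) volume a b := by
  refine intervalIntegrable_div_mul_log (K := K / a ^ 2) ha.le hab hb hf fun s hs => ?_
  have hK0 : 0 ≤ K := (abs_nonneg _).trans (hK s hs)
  refine (hK s hs).trans ?_
  rw [div_mul_eq_mul_div, le_div_iff₀ (by positivity)]
  exact mul_le_mul_of_nonneg_left (pow_le_pow_left₀ ha.le hs.1.le 2) hK0

/-- Quantitative Bernoulli inequality. -/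
lemma abs_one_sub_mul_sub_pow_le {t : ℝ} (h0 : 0 ≤ t) (h1 : t ≤ 1) (y : ℕ) :
    |1 - t * y - (1 - t) ^ y| ≤ y ^ 2 * t ^ 2 := by
  have hB : ∀ n : ℕ, 1 - t * n ≤ (1 - t) ^ n := fun n => by
    have := one_add_mul_le_pow (a := -t) (by linarith) n
    rw [← sub_eq_add_neg] at this
    linarith
  rw [abs_of_nonpos (by linarith [hB y])]
  induction y with
  | zero => simp
  | succ y ih =>
    have h := mul_le_mul_of_nonneg_left (hB y) h0
    push_cast
    rw [pow_succ]
    nlinarith [mul_nonneg h0 (mul_nonneg h0 (Nat.cast_nonneg (α := ℝ) y)), sq_nonneg t]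

/-- The integrand common to all the truncated integrals below. -/
noncomputable def kernelJ (b : ℝ) (x : ℕ) (s : ℝ) : ℝ :=
  (1 - b * s * x - (1 - b * s) ^ x) / (s * Real.log (1 - s))

lemma intervalIntegrable_kernelJ {b : ℝ} (hb0 : 0 ≤ b) (hb1 : b ≤ 1) (x : ℕ) {c d : ℝ}
    (hc : 0 ≤ c) (hcd : c ≤ d) (hd : d ≤ 1) :
    IntervalIntegrable (kernelJ b x) volume c d := by
  refine intervalIntegrable_div_mul_log (K := (x : ℝ) ^ 2) hc hcd hd (by fun_prop) fun s hs => ?_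
  have hs0 : 0 ≤ s := hc.trans hs.1.le
  have hs1 : s ≤ 1 := hs.2.le.trans hd
  have h := abs_one_sub_mul_sub_pow_le (mul_nonneg hb0 hs0) (mul_le_one₀ hb1 hs0 hs1) x
  refine h.trans ?_
  have : b * s ≤ s := mul_le_of_le_one_left hs0 hb1
  gcongr

lemma intervalIntegrable_truncLogGamma {ε : ℝ} (h0 : 0 < ε) (h1 : ε ≤ 1) (y : ℕ) :
    IntervalIntegrable (fun t => (1 - t * y - (1 - t) ^ y) / (t * Real.log (1 - ε * t)))
      volume 0 1 := by
  refine intervalIntegrable_of_bounded (K := y ^ 2 / ε) zero_le_one (by fun_prop) fun t ht => ?_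
  have hε : 0 < ε * t := mul_pos h0 ht.1
  have hε1 : ε * t < 1 := by nlinarith [ht.1, ht.2]
  have h := abs_div_mul_log_le (f := ε * (1 - t * y - (1 - t) ^ y)) (K := y ^ 2 / ε) hε hε1 (by
    rw [abs_mul, abs_of_pos h0]
    have := mul_le_mul_of_nonneg_left (abs_one_sub_mul_sub_pow_le ht.1.le ht.2.le y) h0.le
    rwa [show (y : ℝ) ^ 2 / ε * (ε * t) ^ 2 = ε * (y ^ 2 * t ^ 2) by field_simp])
  rwa [mul_assoc, mul_div_mul_left _ _ h0.ne'] at h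

/-- The expectation of `Λ_ε` under a binomial law. -/
lemma binomExp_truncLogGamma {ε : ℝ} (h0 : 0 < ε) (h1 : ε ≤ 1) (b : ℝ) (x : ℕ) :
    binomExp (b * ε) x (truncLogGamma ε) = ∫ s in (0 : ℝ)..ε, kernelJ b x s := by
  have h2 : ∫ s in (0 : ℝ)..ε, kernelJ b x s = ∫ t in (0 : ℝ)..1, ε * kernelJ b x (ε * t) := by
    rw [intervalIntegral.integral_const_mul, intervalIntegral.mul_integral_comp_mul_left]
    simp
  rw [h2, binomExp]
  simp only [truncLogGamma, ← intervalIntegral.integral_const_mul]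
  rw [← intervalIntegral.integral_finsetSum fun k _ =>
    (intervalIntegrable_truncLogGamma h0 h1 k).const_mul _]
  refine intervalIntegral.integral_congr fun t _ => ?_
  -- The mean is taken under the integral; the generating function turns `(1 - t) ^ k` into `(1 - b
  -- * ε * t) ^ x`.
  have h3 : ∑ k ∈ Finset.range (x + 1), (x.choose k : ℝ) * (b * ε) ^ k * (1 - b * ε) ^ (x - k) *
      ((1 - t * k - (1 - t) ^ k) / (t * Real.log (1 - ε * t))) =
      binomExp (b * ε) x (fun k => 1 - t * k - (1 - t) ^ k) / (t * Real.log (1 - ε * t)) := by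
    rw [binomExp, Finset.sum_div]
    exact Finset.sum_congr rfl fun k _ => by ring
  rw [h3, binomExp_sub, binomExp_sub, binomExp_const, binomExp_const_mul, binomExp_natCast,
    binomExp_pow, kernelJ, mul_assoc ε t, ← mul_div_assoc, mul_div_mul_left _ _ h0.ne']
  ring_nf

/-! ### The integral representation of `log (y!)` -/

/-- The integrand is `∫₀^y u ^ s ds`; exchanging the integrals leaves `∫₀^y ds / (s + 1)`. -/
lemma integral_pow_sub_one_div_log (y : ℕ) :
    ∫ u in (0 : ℝ)..1, (u ^ y - 1) / Real.log u = Real.log (y + 1) := by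
  have hy : (0 : ℝ) ≤ y := Nat.cast_nonneg y
  have h1 : ∫ u in (0 : ℝ)..1, (u ^ y - 1) / Real.log u =
      ∫ u in (0 : ℝ)..1, ∫ s in (0 : ℝ)..y, u ^ s := by
    refine intervalIntegral.integral_congr_Ioo_of_le zero_le_one fun u hu => ?_
    have hlog : Real.log u ≠ 0 := (Real.log_neg hu.1 hu.2).ne
    have hd : ∀ s ∈ Set.uIcc (0 : ℝ) y,
        HasDerivAt (fun s : ℝ => u ^ s / Real.log u) (u ^ s) s := fun s _ => by
      have := ((Real.hasStrictDerivAt_const_rpow hu.1 s).hasDerivAt).div_const (Real.log u)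
      rwa [mul_div_cancel_right₀ _ hlog] at this
    have hc : Continuous fun s : ℝ => u ^ s :=
      continuous_const.rpow continuous_id fun _ => Or.inl hu.1.ne'
    rw [intervalIntegral.integral_eq_sub_of_hasDerivAt hd (hc.intervalIntegrable _ _),
      Real.rpow_natCast, Real.rpow_zero, sub_div]
  have h2 : ∫ u in (0 : ℝ)..1, ∫ s in (0 : ℝ)..y, u ^ s =
      ∫ s in (0 : ℝ)..y, ∫ u in (0 : ℝ)..1, u ^ s := by
    refine intervalIntegral_intervalIntegral_swap ?_
    refine Measure.integrableOn_of_bounded (M := 1) ?_ (Measurable.aestronglyMeasurable ?_) ?_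
    · rw [Measure.volume_eq_prod, Measure.prod_prod]
      exact ENNReal.mul_ne_top (by simp [Set.uIoc]) (by simp [Set.uIoc])
    · exact measurable_fst.pow measurable_snd
    · refine (ae_restrict_iff' (measurableSet_uIoc.prod measurableSet_uIoc)).2
        (Filter.Eventually.of_forall ?_)
      rintro ⟨u, s⟩ ⟨hu, hs⟩
      rw [Set.uIoc_of_le zero_le_one] at hu
      rw [Set.uIoc_of_le hy] at hs
      rw [Function.uncurry_apply_pair, Real.norm_of_nonneg (Real.rpow_nonneg hu.1.le _)]
      exact Real.rpow_le_one hu.1.le hu.2 hs.1.le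
  have h3 : ∫ s in (0 : ℝ)..y, ∫ u in (0 : ℝ)..1, u ^ s = ∫ s in (0 : ℝ)..y, 1 / (s + 1) := by
    refine intervalIntegral.integral_congr fun s hs => ?_
    rw [Set.uIcc_of_le hy] at hs
    rw [integral_rpow (Or.inl (by linarith [hs.1])), Real.one_rpow,
      Real.zero_rpow (by linarith [hs.1]), sub_zero]
  rw [h1, h2, h3, intervalIntegral.integral_comp_add_right (fun s => 1 / s),
    integral_one_div_of_pos (by norm_num) (by positivity)]
  simp

/-- The numerators differ by `t * ((1 - t) ^ y - 1)`, so the factor `t` cancels. -/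
lemma truncLogGamma_one_add_one_sub {ε : ℝ} (h0 : 0 < ε) (h1 : ε ≤ 1) (y : ℕ) :
    truncLogGamma ε (y + 1) - truncLogGamma ε y =
      ∫ t in (0 : ℝ)..1, ((1 - t) ^ y - 1) / Real.log (1 - ε * t) := by
  rw [truncLogGamma, truncLogGamma, ← intervalIntegral.integral_sub
    (intervalIntegrable_truncLogGamma h0 h1 _) (intervalIntegrable_truncLogGamma h0 h1 _)]
  refine intervalIntegral.integral_congr_Ioo_of_le zero_le_one fun t ht => ?_
  rw [← sub_div, ← mul_div_mul_left ((1 - t) ^ y - 1) _ ht.1.ne']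
  push_cast
  ring

lemma truncLogGamma_one (y : ℕ) : truncLogGamma 1 y = Real.log y.factorial := by
  induction y with
  | zero => simp [truncLogGamma]
  | succ y ih =>
    have h := truncLogGamma_one_add_one_sub one_pos le_rfl y
    have h2 := intervalIntegral.integral_comp_sub_left (a := 0) (b := 1)
      (fun u => (u ^ y - 1) / Real.log u) 1
    simp only [sub_zero, sub_self, one_mul] at h h2
    rw [h2, integral_pow_sub_one_div_log] at h
    rw [Nat.factorial_succ, Nat.cast_mul, Real.log_mul (by positivity) (by positivity), ← ih]
    push_cast
    linarith

/-! ### The mean of `g` under the binomial laws -/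

lemma logIntegral_one_sub (c : ℝ) :
    logIntegral (1 - c) = ∫ s in c..1, 1 / Real.log (1 - s) := by
  have h := intervalIntegral.integral_comp_sub_left (a := c) (b := 1)
    (fun u => 1 / Real.log u) 1
  rw [logIntegral, h, sub_self]

lemma etaIntegral_one_sub (c : ℝ) :
    etaIntegral (1 - c) = ∫ s in c..1, 1 / (s * Real.log (1 - s)) := by
  have h := intervalIntegral.integral_comp_sub_left (a := c) (b := 1)
    (fun u => 1 / ((1 - u) * Real.log u)) 1
  simp only [sub_sub_cancel, sub_self] at h
  rw [etaIntegral, h]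

lemma intervalIntegrable_one_div_mul_log {c d : ℝ} (hc : 0 < c) (hcd : c ≤ d) (hd : d ≤ 1) :
    IntervalIntegrable (fun s => 1 / (s * Real.log (1 - s))) volume c d :=
  intervalIntegrable_div_mul_log' (f := fun _ => 1) (K := 1) hc hcd hd (by fun_prop)
    fun s _ => by simp

lemma intervalIntegrable_one_div_log {c d : ℝ} (hc : 0 < c) (hcd : c ≤ d) (hd : d ≤ 1) :
    IntervalIntegrable (fun s => s / (s * Real.log (1 - s))) volume c d :=
  intervalIntegrable_div_mul_log' (f := fun s => s) (K := 1) hc hcd hd (by fun_prop)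
    fun s hs => by rw [abs_of_pos (hc.trans hs.1)]; exact hs.2.le.trans hd

lemma integral_one_div_log {c : ℝ} (hc : 0 < c) (hc1 : c ≤ 1) :
    ∫ s in c..1, 1 / Real.log (1 - s) = ∫ s in c..1, s / (s * Real.log (1 - s)) := by
  refine intervalIntegral.integral_congr_Ioo_of_le hc1 fun s hs => ?_
  have hs0 : s ≠ 0 := (hc.trans hs.1).ne'
  rw [div_mul_eq_div_div, div_self hs0]

/-- Each integral in `R_p` in terms of the integrals that make up `g`. -/
lemma integral_gap_eq {b c : ℝ} (hb0 : 0 ≤ b) (hb1 : b ≤ 1) (hc : 0 < c) (hc1 : c ≤ 1) (x : ℕ)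
    (v : ℝ) :
    ∫ s in c..1, ((1 - b * s) ^ x - v) / (s * Real.log (1 - s)) =
      (1 - v) * (∫ s in c..1, 1 / (s * Real.log (1 - s)))
        - b * x * (∫ s in c..1, 1 / Real.log (1 - s)) - ∫ s in c..1, kernelJ b x s := by
  rw [integral_one_div_log hc hc1, ← intervalIntegral.integral_const_mul,
    ← intervalIntegral.integral_const_mul, ← intervalIntegral.integral_sub,
    ← intervalIntegral.integral_sub]
  · refine intervalIntegral.integral_congr fun s _ => ?_
    simp only [kernelJ]
    ring
  · exact ((intervalIntegrable_one_div_mul_log hc hc1 le_rfl).const_mul _).sub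
      ((intervalIntegrable_one_div_log hc hc1 le_rfl).const_mul _)
  · exact intervalIntegrable_kernelJ hb0 hb1 x hc.le hc1 le_rfl
  · exact (intervalIntegrable_one_div_mul_log hc hc1 le_rfl).const_mul _
  · exact (intervalIntegrable_one_div_log hc hc1 le_rfl).const_mul _

lemma log_factorial_eq_integral (x : ℕ) :
    Real.log x.factorial = ∫ s in (0 : ℝ)..1, kernelJ 1 x s := by
  rw [← truncLogGamma_one]
  simp [truncLogGamma, kernelJ]

lemma expLogFactorial_eq_binomExp (ε : ℝ) (x : ℕ) :
    expLogFactorial ε x = binomExp ε x (fun k => Real.log k.factorial) := rfl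

lemma expLogFactorial_eq_integral (b : ℝ) (x : ℕ) :
    expLogFactorial b x = ∫ s in (0 : ℝ)..1, kernelJ b x s := by
  rw [← binomExp_truncLogGamma one_pos le_rfl b x, mul_one, expLogFactorial_eq_binomExp]
  simp only [← truncLogGamma_one]

lemma integral_kernelJ_split {b c : ℝ} (hb0 : 0 ≤ b) (hb1 : b ≤ 1) (hc : 0 ≤ c) (hc1 : c ≤ 1)
    (x : ℕ) :
    (∫ s in (0 : ℝ)..c, kernelJ b x s) + ∫ s in c..1, kernelJ b x s =
      ∫ s in (0 : ℝ)..1, kernelJ b x s :=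
  intervalIntegral.integral_add_adjacent_intervals
    (intervalIntegrable_kernelJ hb0 hb1 x le_rfl hc hc1)
    (intervalIntegrable_kernelJ hb0 hb1 x hc hc1 le_rfl)

lemma expLogFactorial_zero (ε : ℝ) : expLogFactorial ε 0 = 0 := by simp [expLogFactorial]

lemma truncLogGamma_zero (ε : ℝ) : truncLogGamma ε 0 = 0 := by simp [truncLogGamma]

lemma gTrunc_eq (p : ℝ) (y : ℕ) :
    gTrunc p y = gFun p y - if y = 0 then gFun p 0 else 0 := by
  by_cases h : y = 0 <;> simp [gTrunc, h]

lemma one_sub_div_one_sub {p : ℝ} (hp : p < 1) : (1 - 2 * p) / (1 - p) = 1 - p / (1 - p) := by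
  have : 1 - p ≠ 0 := by linarith
  field_simp
  ring

/-- The mean of `g` under the binomial laws. -/
theorem binomExp_gTrunc {p : ℝ} (hp0 : 0 < p) (hp1 : p < 1) (x : ℕ) :
    binomExp p x (gTrunc p) =
      Real.log x.factorial - expLogFactorial (1 - p) x + kktGap p x := by
  -- Resetting `g(0)` to `0` costs `gFun p 0` times `P(Y_x = 0)`; this is the source of the `(1 - p)
  -- ^ x` in the gap.
  have hE : binomExp p x (gTrunc p) = binomExp p x (gFun p) - gFun p 0 * (1 - p) ^ x := by
    rw [← binomExp_indicator_zero, ← binomExp_sub]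
    simp only [← gTrunc_eq]
  have hL : binomExp p x (truncLogGamma p) = ∫ s in (0 : ℝ)..p, kernelJ 1 x s := by
    simpa using binomExp_truncLogGamma hp0 hp1.le 1 x
  have hq : (1 - p) ≠ 0 := by linarith
  have hgap := integral_gap_eq zero_le_one le_rfl hp0 hp1.le x ((1 - p) ^ x)
  have hsplit := integral_kernelJ_split zero_le_one le_rfl hp0.le hp1.le x
  simp only [one_mul] at hgap
  rw [hE, log_factorial_eq_integral, kktGap]
  simp only [Real.rpow_natCast]
  by_cases hp : p < 1 / 2
  · have hc1 : p / (1 - p) ≤ 1 := by rw [div_le_one (by linarith)]; linarith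
    have hc0 : 0 < p / (1 - p) := div_pos hp0 (by linarith)
    have hpc : p ≤ p / (1 - p) := by
      rw [le_div_iff₀ (by linarith)]; nlinarith
    have hg : gFun p = fun y : ℕ => truncLogGamma p y - truncLogGamma (p / (1 - p)) y
        + ((1 - p) * logIntegral ((1 - 2 * p) / (1 - p)) - logIntegral (1 - p)) / p * (y : ℝ)
        + ∫ t in p..(p / (1 - p)), 1 / (t * Real.log (1 - t)) := by
      ext y; rw [gFun, if_pos hp]; ring
    -- Here `p = (1 - p) * (p / (1 - p))`, so the scale is `b = 1 - p`.
    have hL' : binomExp p x (truncLogGamma (p / (1 - p))) =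
        ∫ s in (0 : ℝ)..(p / (1 - p)), kernelJ (1 - p) x s := by
      rw [← binomExp_truncLogGamma hc0 hc1, mul_div_cancel₀ _ hq]
    have hgap' := integral_gap_eq (b := 1 - p) (by linarith) (by linarith) hc0 hc1 x
      ((1 - p) ^ x)
    have hsplit' := integral_kernelJ_split (b := 1 - p) (by linarith) (by linarith) hc0.le hc1 x
    have hadj := intervalIntegral.integral_add_adjacent_intervals
      (intervalIntegrable_one_div_mul_log hp0 hpc hc1)
      (intervalIntegrable_one_div_mul_log hc0 hc1 le_rfl)
    rw [if_pos hp, hgap, hgap', expLogFactorial_eq_integral]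
    rw [hg, binomExp_add, binomExp_add, binomExp_sub, binomExp_const_mul, binomExp_const,
      binomExp_natCast, hL, hL', one_sub_div_one_sub hp1, logIntegral_one_sub,
      logIntegral_one_sub, ← hsplit, ← hsplit', ← hadj]
    simp only [truncLogGamma_zero, Nat.cast_zero]
    field_simp
    ring
  · have hg : gFun p = fun y : ℕ => truncLogGamma p y - expLogFactorial (1 / p - 1) y
        - logIntegral (1 - p) / p * (y : ℝ) + etaIntegral (1 - p) := by
      ext y; rw [gFun, if_neg hp]; ring
    have hE' : binomExp p x (expLogFactorial (1 / p - 1)) = expLogFactorial (1 - p) x := by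
      have := binomExp_binomExp p (1 / p - 1) x (fun k => Real.log k.factorial)
      rw [show p * (1 / p - 1) = 1 - p by field_simp] at this
      exact this
    rw [if_neg hp, hgap, sub_zero]
    rw [hg, binomExp_add, binomExp_sub, binomExp_sub, binomExp_const_mul, binomExp_const,
      binomExp_natCast, hL, hE', logIntegral_one_sub, etaIntegral_one_sub,
      ← hsplit]
    simp only [truncLogGamma_zero, expLogFactorial_zero, Nat.cast_zero]
    field_simp
    ring

/-! ### Sign and decay of the gap -/

lemma intervalIntegrable_gap {b c v : ℝ} (hb0 : 0 ≤ b) (hb1 : b ≤ 1) (hc : 0 < c) (hc1 : c ≤ 1)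
    {x : ℝ} (hx : 0 ≤ x) :
    IntervalIntegrable (fun s => ((1 - b * s) ^ x - v) / (s * Real.log (1 - s))) volume c 1 := by
  refine intervalIntegrable_div_mul_log' (K := 1 + |v|) hc hc1 le_rfl
    (by fun_prop) fun s hs => ?_
  have h0 : 0 ≤ s := hc.le.trans hs.1.le
  have h1 : b * s ≤ 1 := mul_le_one₀ hb1 h0 hs.2.le
  refine (abs_sub _ _).trans (add_le_add_left ?_ _)
  rw [abs_of_nonneg (Real.rpow_nonneg (by linarith) _)]
  exact Real.rpow_le_one (by linarith) (by nlinarith) hx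

lemma mul_log_one_sub_neg {s : ℝ} (h0 : 0 < s) (h1 : s < 1) : s * Real.log (1 - s) < 0 :=
  mul_neg_of_pos_of_neg h0 (by linarith [le_neg_log_one_sub h1])

/-- On `[p, 1]` numerator and denominator are both nonpositive. For `p < 1/2`, `1 - (1 - p) s ≥ 1 -
s` makes the second integrand at most the first where both are present. -/
theorem kktGap_nonneg {p : ℝ} (hp0 : 0 < p) (hp1 : p < 1) {x : ℝ} (hx : 0 ≤ x) :
    0 ≤ kktGap p x := by
  have hnn : ∀ s ∈ Set.Icc p 1, 0 ≤ ((1 - s) ^ x - (1 - p) ^ x) / (s * Real.log (1 - s)) := by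
    intro s hs
    -- At `s = 1` the convention `Real.log 0 = 0` makes the quotient `0`.
    rcases hs.2.eq_or_lt with rfl | h1
    · simp
    · refine div_nonneg_of_nonpos ?_ (mul_log_one_sub_neg (hp0.trans_le hs.1) h1).le
      exact sub_nonpos.2 (Real.rpow_le_rpow (by linarith) (by linarith [hs.1]) hx)
  rw [kktGap]
  by_cases hp : p < 1 / 2
  · have hc1 : p / (1 - p) ≤ 1 := by rw [div_le_one (by linarith)]; linarith
    have hc0 : 0 < p / (1 - p) := div_pos hp0 (by linarith)
    have hpc : p ≤ p / (1 - p) := by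
      rw [le_div_iff₀ (by linarith)]; nlinarith
    have hI := intervalIntegrable_gap (b := 1) (v := (1 - p) ^ x) zero_le_one le_rfl hp0 hp1.le hx
    have hI' := intervalIntegrable_gap (b := 1) (v := (1 - p) ^ x) zero_le_one le_rfl hc0 hc1 hx
    simp only [one_mul] at hI hI'
    have hI1 := hI.mono_set (c := p) (d := p / (1 - p)) (by
      rw [Set.uIcc_of_le hpc, Set.uIcc_of_le hp1.le]; exact Set.Icc_subset_Icc_right hc1)
    rw [if_pos hp, ← intervalIntegral.integral_add_adjacent_intervals hI1 hI']
    have h1 := intervalIntegral.integral_nonneg (μ := volume) hpc fun s hs => hnn s ⟨hs.1, hs.2.trans hc1⟩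
    have h2 := intervalIntegral.integral_mono_on hc1 (intervalIntegrable_gap (b := 1 - p)
      (v := (1 - p) ^ x) (by linarith) (by linarith) hc0 hc1 hx) hI' fun s hs => by
        rcases hs.2.eq_or_lt with rfl | h1
        · simp
        · have hs0 := hc0.trans_le hs.1
          refine div_le_div_of_nonpos_of_le (mul_log_one_sub_neg hs0 h1).le ?_
          refine sub_le_sub_right (Real.rpow_le_rpow (by linarith) ?_ hx) _
          nlinarith
    linarith
  · rw [if_neg hp, sub_zero]
    exact intervalIntegral.integral_nonneg hp1.le hnn

/-- The subtracted integral is nonnegative because `(1 - p) s ≥ p` on its range. In the first, the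
numerator is at most `(1 - p) ^ x` in size and the denominator at least `p ^ 2`. -/
theorem kktGap_le {p : ℝ} (hp0 : 0 < p) (hp1 : p < 1) {x : ℝ} (hx : 0 ≤ x) :
    kktGap p x ≤ 1 / p ^ 2 * (1 - p) ^ x := by
  have hq : 0 < 1 - p := by linarith
  have hv : 0 ≤ (1 - p) ^ x := Real.rpow_nonneg hq.le x
  have h1 : ∫ s in p..1, ((1 - s) ^ x - (1 - p) ^ x) / (s * Real.log (1 - s)) ≤
      1 / p ^ 2 * (1 - p) ^ x := by
    have h := intervalIntegral.norm_integral_le_of_norm_le_const_ae (a := p) (b := 1)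
      (f := fun s => ((1 - s) ^ x - (1 - p) ^ x) / (s * Real.log (1 - s)))
      (C := 1 / p ^ 2 * (1 - p) ^ x) (Filter.Eventually.of_forall fun s hs => by
        rw [Set.uIoc_of_le hp1.le] at hs
        rcases hs.2.eq_or_lt with rfl | h1
        · simp; positivity
        · refine abs_div_mul_log_le (hp0.trans hs.1) h1 ?_
          have ha : 0 ≤ (1 - s) ^ x := Real.rpow_nonneg (by linarith) x
          have hb : (1 - s) ^ x ≤ (1 - p) ^ x :=
            Real.rpow_le_rpow (by linarith) (by linarith [hs.1]) hx
          rw [abs_of_nonpos (by linarith)]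
          have hs2 : 1 ≤ s ^ 2 / p ^ 2 := by
            rw [one_le_div (by positivity)]
            exact pow_le_pow_left₀ hp0.le hs.1.le 2
          calc -((1 - s) ^ x - (1 - p) ^ x) ≤ (1 - p) ^ x := by linarith
            _ ≤ (1 - p) ^ x * (s ^ 2 / p ^ 2) := le_mul_of_one_le_right hv hs2
            _ = _ := by ring)
    refine (Real.le_norm_self _).trans (h.trans ?_)
    rw [abs_of_pos hq]
    exact mul_le_of_le_one_right (by positivity) (by linarith)
  rw [kktGap]
  refine (sub_le_self _ ?_).trans h1
  split_ifs with hp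
  · have hc1 : p / (1 - p) ≤ 1 := by rw [div_le_one (by linarith)]; linarith
    refine intervalIntegral.integral_nonneg hc1 fun s hs => ?_
    have hs0 : 0 < s := (div_pos hp0 hq).trans_le hs.1
    rcases hs.2.eq_or_lt with rfl | h1
    · simp
    · refine div_nonneg_of_nonpos ?_ (mul_log_one_sub_neg hs0 h1).le
      refine sub_nonpos.2 (Real.rpow_le_rpow (by nlinarith) ?_ hx)
      have := (div_le_iff₀ hq).1 hs.1
      linarith
  · exact le_rfl

/-! ### Sequences that are linear up to a logarithmic error -/

/-- `f y = c y + O(log y)`. -/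
def IsLinLog (c : ℝ) (f : ℕ → ℝ) : Prop :=
  ∃ K : ℝ, 0 ≤ K ∧ ∀ y : ℕ, |f y - c * y| ≤ K * (1 + Real.log (y + 1))

lemma log_natCast_add_one_nonneg (y : ℕ) : 0 ≤ Real.log ((y : ℝ) + 1) :=
  Real.log_nonneg (by linarith [Nat.cast_nonneg (α := ℝ) y])

lemma IsLinLog.add {c d : ℝ} {f g : ℕ → ℝ} (hf : IsLinLog c f) (hg : IsLinLog d g) :
    IsLinLog (c + d) (fun y => f y + g y) := by
  obtain ⟨K, hK, hf⟩ := hf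
  obtain ⟨M, hM, hg⟩ := hg
  refine ⟨K + M, add_nonneg hK hM, fun y => ?_⟩
  rw [show f y + g y - (c + d) * y = (f y - c * y) + (g y - d * y) by ring, add_mul]
  exact (abs_add_le _ _).trans (add_le_add (hf y) (hg y))

lemma IsLinLog.neg {c : ℝ} {f : ℕ → ℝ} (hf : IsLinLog c f) :
    IsLinLog (-c) (fun y => -f y) := by
  obtain ⟨K, hK, hf⟩ := hf
  refine ⟨K, hK, fun y => ?_⟩
  rw [show -f y - -c * y = -(f y - c * y) by ring, abs_neg]
  exact hf y

lemma IsLinLog.sub {c d : ℝ} {f g : ℕ → ℝ} (hf : IsLinLog c f) (hg : IsLinLog d g) :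
    IsLinLog (c - d) (fun y => f y - g y) := by
  simpa only [sub_eq_add_neg] using hf.add hg.neg

lemma isLinLog_mul (c : ℝ) : IsLinLog c (fun y => c * y) :=
  ⟨0, le_rfl, fun y => by simp⟩

lemma isLinLog_of_bounded {f : ℕ → ℝ} {M : ℝ} (h : ∀ y, |f y| ≤ M) : IsLinLog 0 f := by
  have hM : 0 ≤ M := (abs_nonneg _).trans (h 0)
  refine ⟨M, hM, fun y => ?_⟩
  rw [zero_mul, sub_zero]
  exact (h y).trans (le_mul_of_one_le_right hM (by linarith [log_natCast_add_one_nonneg y]))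

lemma isLinLog_of_increment {c K : ℝ} {f : ℕ → ℝ}
    (h : ∀ y : ℕ, |f (y + 1) - f y - c| ≤ K / (y + 1)) : IsLinLog c f := by
  have hK : 0 ≤ K := by simpa using (abs_nonneg _).trans (h 0)
  have key : ∀ y : ℕ, |f y - c * y| ≤ |f 0| + 2 * K * Real.log (y + 1) := by
    intro y
    induction y with
    | zero => simp
    | succ y ih =>
      have hy : (0 : ℝ) ≤ y := Nat.cast_nonneg y
      -- The 2 comes from `1/(y+1) ≤ 2/(y+2)` and `1/(y+2) ≤ log ((y+2)/(y+1))`.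
      have h1 : 1 / ((y : ℝ) + 1) ≤ 2 * (Real.log (y + 1 + 1) - Real.log (y + 1)) := by
        rw [← Real.log_div (by positivity) (by positivity)]
        have := Real.one_sub_inv_le_log_of_pos
          (show 0 < ((y : ℝ) + 1 + 1) / (y + 1) by positivity)
        refine le_trans ?_ (mul_le_mul_of_nonneg_left this zero_le_two)
        rw [inv_div, one_sub_div (by positivity), ← mul_div_assoc,
          div_le_div_iff₀ (by positivity) (by positivity)]
        linarith
      have h2 : K / (y + 1) ≤ K * (2 * (Real.log (y + 1 + 1) - Real.log (y + 1))) := by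
        rw [div_eq_mul_one_div]
        exact mul_le_mul_of_nonneg_left h1 hK
      push_cast
      rw [show f (y + 1) - c * (y + 1) = (f (y + 1) - f y - c) + (f y - c * y) by ring]
      linarith [abs_add_le (f (y + 1) - f y - c) (f y - c * y), h y]
  refine ⟨|f 0| + 2 * K, by positivity, fun y => (key y).trans ?_⟩
  nlinarith [log_natCast_add_one_nonneg y, abs_nonneg (f 0),
    mul_nonneg (abs_nonneg (f 0)) (log_natCast_add_one_nonneg y)]

/-! ### Asymptotics of `Λ_ε` and `𝓔_ε` -/

lemma one_div_neg_log_mem {s : ℝ} (h0 : 0 < s) (h1 : s < 1) :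
    1 / s - 1 ≤ 1 / -Real.log (1 - s) ∧ 1 / -Real.log (1 - s) ≤ 1 / s := by
  have hs : 0 < 1 - s := by linarith
  have h2 := le_neg_log_one_sub h1
  have h3 : -Real.log (1 - s) ≤ s / (1 - s) := by
    have h := Real.one_sub_inv_le_log_of_pos hs
    have : s / (1 - s) = (1 - s)⁻¹ - 1 := by field_simp; ring
    linarith
  refine ⟨?_, one_div_le_one_div_of_le h0 h2⟩
  have h4 := one_div_le_one_div_of_le (h0.trans_le h2) h3
  rwa [one_div_div, sub_div, div_self h0.ne'] at h4

/-- Both terms have the same singular part `-1 / (ε t)`, which cancels. -/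
lemma abs_one_div_log_sub_le {ε t : ℝ} (h0 : 0 < ε) (h1 : ε ≤ 1) (ht0 : 0 < t) (ht1 : t < 1) :
    |1 / Real.log (1 - ε * t) - 1 / ε * (1 / Real.log (1 - t))| ≤ 1 / ε := by
  obtain ⟨h2, h3⟩ := one_div_neg_log_mem (mul_pos h0 ht0) (by nlinarith)
  obtain ⟨h4, h5⟩ := one_div_neg_log_mem ht0 ht1
  have hε : 1 ≤ 1 / ε := (one_le_div h0).2 h1
  have h6 : 1 / (ε * t) = 1 / ε * (1 / t) := by rw [one_div_mul_one_div]
  rw [one_div_neg_eq_neg_one_div] at h2 h3 h4 h5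
  rw [h6] at h2 h3
  have h7 := mul_le_mul_of_nonneg_left h4 (zero_le_one.trans hε)
  have h8 := mul_le_mul_of_nonneg_left h5 (zero_le_one.trans hε)
  rw [abs_le]
  constructor <;> linarith

lemma intervalIntegrable_pow_sub_one_div_log {ε : ℝ} (h0 : 0 < ε) (h1 : ε ≤ 1) (y : ℕ) :
    IntervalIntegrable (fun t => ((1 - t) ^ y - 1) / Real.log (1 - ε * t)) volume 0 1 := by
  refine intervalIntegrable_of_bounded (K := y / ε) zero_le_one (by fun_prop) fun t ht => ?_
  have hε1 : ε * t < 1 := by nlinarith [ht.1, ht.2]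
  have hl := le_neg_log_one_sub hε1
  have hεt : 0 < ε * t := mul_pos h0 ht.1
  have hB := one_add_mul_le_pow (a := -t) (by linarith [ht.2]) y
  rw [← sub_eq_add_neg] at hB
  have hP : (1 - t) ^ y ≤ 1 := pow_le_one₀ (by linarith [ht.2]) (by linarith [ht.1])
  rw [abs_div, abs_of_nonpos (by linarith), abs_of_neg (by linarith),
    div_le_iff₀ (by linarith)]
  calc -((1 - t) ^ y - 1) ≤ y / ε * (ε * t) := by field_simp; linarith
    _ ≤ _ := by gcongr

/-- As `log y! = Λ_1(y)`, the increment is `∫ ((1 - t) ^ y - 1) B` with `|B| ≤ 1/ε`: the constant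
`-∫ B` plus an error at most `(1/ε) / (y + 1)`. -/
lemma exists_isLinLog_truncLogGamma {ε : ℝ} (h0 : 0 < ε) (h1 : ε ≤ 1) :
    ∃ c, IsLinLog c (fun y => truncLogGamma ε y - 1 / ε * Real.log y.factorial) := by
  set B : ℝ → ℝ := fun t => 1 / Real.log (1 - ε * t) - 1 / ε * (1 / Real.log (1 - t)) with hB
  have hBm : Measurable B := by fun_prop
  have hBi : IntervalIntegrable B volume 0 1 :=
    intervalIntegrable_of_bounded zero_le_one hBm fun t ht =>
      abs_one_div_log_sub_le h0 h1 ht.1 ht.2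
  refine ⟨-∫ t in (0 : ℝ)..1, B t, isLinLog_of_increment (K := 1 / ε) fun y => ?_⟩
  have h2 := truncLogGamma_one_add_one_sub h0 h1 y
  have h3 := truncLogGamma_one_add_one_sub one_pos le_rfl y
  have hi2 := intervalIntegrable_pow_sub_one_div_log h0 h1 y
  have hi3 := intervalIntegrable_pow_sub_one_div_log one_pos le_rfl y
  simp only [one_mul] at h3 hi3
  have h4 : truncLogGamma ε (y + 1) - 1 / ε * Real.log (y + 1).factorial -
      (truncLogGamma ε y - 1 / ε * Real.log y.factorial) - -∫ t in (0 : ℝ)..1, B t =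
      ∫ t in (0 : ℝ)..1, (1 - t) ^ y * B t := by
    have h5 : ∫ t in (0 : ℝ)..1, (1 - t) ^ y * B t = ∫ t in (0 : ℝ)..1,
        (((1 - t) ^ y - 1) / Real.log (1 - ε * t)
          - 1 / ε * (((1 - t) ^ y - 1) / Real.log (1 - t)) + B t) := by
      refine intervalIntegral.integral_congr fun t _ => ?_
      simp only [hB]
      ring
    rw [h5, intervalIntegral.integral_add (hi2.sub (hi3.const_mul _)) hBi,
      intervalIntegral.integral_sub hi2 (hi3.const_mul _), intervalIntegral.integral_const_mul,
      ← h2, ← h3, truncLogGamma_one, truncLogGamma_one]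
    ring
  rw [h4]
  have h6 : ∫ t in (0 : ℝ)..1, 1 / ε * (1 - t) ^ y = 1 / ε / (y + 1) := by
    have := intervalIntegral.integral_comp_sub_left (a := 0) (b := 1) (fun u : ℝ => u ^ y) 1
    rw [intervalIntegral.integral_const_mul, this]
    simp [div_eq_mul_inv]
  rw [← h6, ← Real.norm_eq_abs]
  refine intervalIntegral.norm_integral_le_of_norm_le zero_le_one ?_
    ((by fun_prop : Continuous fun t : ℝ => 1 / ε * (1 - t) ^ y).intervalIntegrable _ _)
  have hne : ∀ᵐ t : ℝ, t ≠ 1 := by simp [ae_iff]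
  filter_upwards [hne] with t ht1 ht
  have hlt : t < 1 := lt_of_le_of_ne ht.2 ht1
  have hp : 0 ≤ (1 - t) ^ y := pow_nonneg (by linarith) y
  rw [norm_mul, Real.norm_of_nonneg hp, mul_comm]
  exact mul_le_mul_of_nonneg_right (abs_one_div_log_sub_le h0 h1 ht.1 hlt) hp

lemma log_factorial_succ (y : ℕ) :
    Real.log (y + 1).factorial = Real.log y.factorial + Real.log (y + 1) := by
  rw [Nat.factorial_succ, Nat.cast_mul, Real.log_mul (by positivity) (by positivity), add_comm]
  push_cast
  rfl

lemma expLogFactorial_succ_sub (ε : ℝ) (y : ℕ) :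
    expLogFactorial ε (y + 1) - expLogFactorial ε y =
      ε * binomExp ε y (fun k => Real.log (k + 1)) := by
  simp only [expLogFactorial_eq_binomExp]
  rw [binomExp_succ]
  simp only [log_factorial_succ]
  rw [binomExp_add]
  ring

/-- The increment is `ε E[log (Z + 1)]`, compared with `ε log (ε (y + 1))` by averaging `1 - 1/u ≤
log u ≤ u - 1` at `u = (Z + 1) / (ε (y + 1))`. -/
lemma isLinLog_expLogFactorial {ε : ℝ} (h0 : 0 < ε) (h1 : ε ≤ 1) :
    IsLinLog (ε * Real.log ε) (fun y => expLogFactorial ε y - ε * Real.log y.factorial) := by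
  refine isLinLog_of_increment (K := 1) fun y => ?_
  have hy : (0 : ℝ) < y + 1 := by positivity
  have h2 := expLogFactorial_succ_sub ε y
  set L := binomExp ε y (fun k => Real.log (k + 1)) with hL
  have hlog : ∀ k : ℕ, Real.log (((k : ℝ) + 1) / (ε * (y + 1))) =
      Real.log (k + 1) - (Real.log ε + Real.log (y + 1)) := fun k => by
    rw [Real.log_div (by positivity) (by positivity), Real.log_mul h0.ne' hy.ne']
  have h3 : L - (Real.log ε + Real.log (y + 1)) =
      binomExp ε y (fun k => Real.log (((k : ℝ) + 1) / (ε * (y + 1)))) := by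
    simp only [hlog]
    rw [binomExp_sub, binomExp_const]
  have h4 : 0 ≤ L - (Real.log ε + Real.log (y + 1)) := by
    have h5 : binomExp ε y (fun k => 1 - ε * (y + 1) * (1 / ((k : ℝ) + 1))) ≤
        L - (Real.log ε + Real.log (y + 1)) := by
      rw [h3]
      refine binomExp_mono h0.le h1 fun k _ => ?_
      have := Real.one_sub_inv_le_log_of_pos
        (show 0 < ((k : ℝ) + 1) / (ε * (y + 1)) by positivity)
      rwa [inv_div, div_eq_mul_one_div] at this
    rw [binomExp_sub, binomExp_const, binomExp_const_mul, binomExp_inv_succ] at h5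
    have : 0 ≤ (1 - ε) ^ (y + 1) := pow_nonneg (by linarith) _
    linarith
  have h6 : L - (Real.log ε + Real.log (y + 1)) ≤ 1 / ε / (y + 1) := by
    have h7 : L - (Real.log ε + Real.log (y + 1)) ≤
        binomExp ε y (fun k => 1 / (ε * (y + 1)) * ((k : ℝ) + 1) - 1) := by
      rw [h3]
      refine binomExp_mono h0.le h1 fun k _ => ?_
      have := Real.log_le_sub_one_of_pos
        (show 0 < ((k : ℝ) + 1) / (ε * (y + 1)) by positivity)
      rwa [one_div_mul_eq_div]
    rw [binomExp_sub, binomExp_const_mul, binomExp_add, binomExp_natCast, binomExp_const] at h7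
    refine h7.trans ?_
    rw [sub_le_iff_le_add, div_div, one_div_mul_eq_div, div_add_one (by positivity)]
    exact div_le_div_of_nonneg_right (by nlinarith) (by positivity)
  rw [log_factorial_succ, show expLogFactorial ε (y + 1) -
    ε * (Real.log y.factorial + Real.log (y + 1)) -
    (expLogFactorial ε y - ε * Real.log y.factorial) - ε * Real.log ε =
    ε * (L - (Real.log ε + Real.log (y + 1))) by linear_combination h2,
    abs_of_nonneg (mul_nonneg h0.le h4)]
  refine (mul_le_mul_of_nonneg_left h6 h0.le).trans_eq ?_
  field_simp

/-- In both cases the coefficient of `log y!` is `1/p - (1 - p)/p = 1`. -/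
lemma exists_isLinLog_gTrunc {p : ℝ} (hp0 : 0 < p) (hp1 : p < 1) :
    ∃ c, IsLinLog c (fun y => gTrunc p y - Real.log y.factorial) := by
  have hq : 0 < 1 - p := by linarith
  have hz : IsLinLog 0 (fun y => if y = 0 then gFun p 0 else 0) :=
    isLinLog_of_bounded (M := |gFun p 0|) fun y => by split_ifs <;> simp
  suffices h : ∃ c, IsLinLog c (fun y => gFun p y - Real.log y.factorial) by
    obtain ⟨c, hc⟩ := h
    refine ⟨c - 0, ?_⟩
    convert hc.sub hz using 2 with y
    rw [gTrunc_eq]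
    ring
  obtain ⟨a, ha⟩ := exists_isLinLog_truncLogGamma hp0 hp1.le
  by_cases hp : p < 1 / 2
  · obtain ⟨b, hb⟩ := exists_isLinLog_truncLogGamma (ε := p / (1 - p)) (div_pos hp0 hq)
      (by rw [div_le_one hq]; linarith)
    set l := ((1 - p) * logIntegral ((1 - 2 * p) / (1 - p)) - logIntegral (1 - p)) / p with hl
    have h := ((ha.sub hb).add (isLinLog_mul l)).add (isLinLog_of_bounded
      (f := fun _ => ∫ t in p..(p / (1 - p)), 1 / (t * Real.log (1 - t))) fun _ => le_rfl)
    refine ⟨_, Eq.subst (motive := IsLinLog _) (funext fun y => ?_) h⟩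
    rw [gFun, if_pos hp, hl]
    field_simp
    ring
  · have hp' : 1 / 2 ≤ p := not_lt.1 hp
    have he : 1 / p - 1 = (1 - p) / p := by field_simp
    have hb := isLinLog_expLogFactorial (ε := 1 / p - 1) (by rw [he]; positivity)
      (by rw [he, div_le_one hp0]; linarith)
    have h := ((ha.sub hb).sub (isLinLog_mul (logIntegral (1 - p) / p))).add (isLinLog_of_bounded
      (f := fun _ => etaIntegral (1 - p)) fun _ => le_rfl)
    refine ⟨_, Eq.subst (motive := IsLinLog _) (funext fun y => ?_) h⟩
    rw [gFun, if_neg hp]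
    ring

/-! ### The entropy of the binomial law -/

lemma log_binomial_mass {p : ℝ} (hp0 : 0 < p) (hp1 : p < 1) {x k : ℕ} (hk : k ≤ x) :
    Real.log ((x.choose k : ℝ) * p ^ k * (1 - p) ^ (x - k)) =
      Real.log x.factorial - Real.log k.factorial - Real.log (x - k).factorial
        + (Real.log p - Real.log (1 - p)) * k + x * Real.log (1 - p) := by
  have hq : 0 < 1 - p := by linarith
  have hc : (0 : ℝ) < x.choose k := by exact_mod_cast Nat.choose_pos hk
  rw [Real.log_mul (by positivity) (by positivity), Real.log_mul (by positivity) (by positivity),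
    Real.log_pow, Real.log_pow, Nat.cast_choose ℝ hk, Real.log_div (by positivity) (by positivity),
    Real.log_mul (by positivity) (by positivity), Nat.cast_sub hk]
  ring

lemma binomExp_log_mass {p : ℝ} (hp0 : 0 < p) (hp1 : p < 1) (x : ℕ) :
    binomExp p x (fun k => Real.log ((x.choose k : ℝ) * p ^ k * (1 - p) ^ (x - k))) =
      Real.log x.factorial - binomExp p x (fun k => Real.log k.factorial)
        - expLogFactorial (1 - p) x - x * Real.binEntropy p := by
  have h : binomExp p x (fun k => Real.log ((x.choose k : ℝ) * p ^ k * (1 - p) ^ (x - k))) =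
      binomExp p x (fun k => Real.log x.factorial - Real.log k.factorial
        - Real.log (x - k).factorial
        + (Real.log p - Real.log (1 - p)) * k + x * Real.log (1 - p)) :=
    Finset.sum_congr rfl fun k hk => by
      simp only []
      rw [log_binomial_mass hp0 hp1 (Nat.lt_succ_iff.1 (Finset.mem_range.1 hk))]
  rw [h, binomExp_add, binomExp_add, binomExp_sub, binomExp_sub, binomExp_const, binomExp_const,
    binomExp_const_mul, binomExp_natCast,
    binomExp_flip p x (fun k => Real.log k.factorial), ← expLogFactorial_eq_binomExp (1 - p),
    Real.binEntropy, Real.log_inv, Real.log_inv]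
  ring

lemma binomial_mass_nonneg {p : ℝ} (hp0 : 0 < p) (hp1 : p < 1) (x k : ℕ) :
    0 ≤ (x.choose k : ℝ) * p ^ k * (1 - p) ^ (x - k) := by
  have : 0 < 1 - p := by linarith
  positivity

lemma binomial_mass_le_one {p : ℝ} (hp0 : 0 < p) (hp1 : p < 1) {x k : ℕ} (hk : k ≤ x) :
    (x.choose k : ℝ) * p ^ k * (1 - p) ^ (x - k) ≤ 1 := by
  have h := binomExp_const p x 1
  simp only [binomExp, mul_one] at h
  refine le_of_le_of_eq ?_ h
  exact Finset.single_le_sum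
    (f := fun k => (x.choose k : ℝ) * p ^ k * (1 - p) ^ (x - k))
    (fun i _ => binomial_mass_nonneg hp0 hp1 x i) (Finset.mem_range.2 (Nat.lt_succ_of_le hk))

lemma binomExp_log_mass_nonpos {p : ℝ} (hp0 : 0 < p) (hp1 : p < 1) (x : ℕ) :
    binomExp p x (fun k => Real.log ((x.choose k : ℝ) * p ^ k * (1 - p) ^ (x - k))) ≤ 0 := by
  rw [← binomExp_const p x 0]
  exact binomExp_mono hp0.le hp1.le fun k hk =>
    Real.log_nonpos (binomial_mass_nonneg hp0 hp1 x k) (binomial_mass_le_one hp0 hp1 hk)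

/-! ### Growth of the weights -/

/-- The exponent of the weight of `y`, apart from the geometric factor `q ^ y`. -/
noncomputable def logWeight (p : ℝ) (y : ℕ) : ℝ :=
  gTrunc p y - Real.log y.factorial - Real.binEntropy p / p * y

lemma binomExp_logWeight {p : ℝ} (hp0 : 0 < p) (hp1 : p < 1) (x : ℕ) :
    binomExp p x (logWeight p) = kktGap p x +
      binomExp p x (fun k => Real.log ((x.choose k : ℝ) * p ^ k * (1 - p) ^ (x - k))) := by
  have h : binomExp p x (logWeight p) = binomExp p x (fun y =>
    gTrunc p y - Real.log y.factorial - Real.binEntropy p / p * y) := rfl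
  have h2 := binomExp_gTrunc hp0 hp1 x
  rw [h, binomExp_log_mass hp0 hp1, binomExp_sub, binomExp_sub, binomExp_const_mul,
    binomExp_natCast]
  have h3 : binomExp p x (fun y => gTrunc p y) = _ := h2
  rw [h3]
  field_simp
  ring

lemma binomExp_logWeight_le {p : ℝ} (hp0 : 0 < p) (hp1 : p < 1) (x : ℕ) :
    binomExp p x (logWeight p) ≤ 1 / p ^ 2 := by
  have h1 := kktGap_le hp0 hp1 (Nat.cast_nonneg (α := ℝ) x)
  have h2 : (1 - p) ^ (x : ℝ) ≤ 1 :=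
    Real.rpow_le_one (by linarith) (by linarith) (Nat.cast_nonneg x)
  have h3 := mul_le_of_le_one_right (a := 1 / p ^ 2) (by positivity) h2
  linarith [binomExp_logWeight hp0 hp1 x, binomExp_log_mass_nonpos hp0 hp1 x]

/-- A sequence whose binomial means are bounded above has no positive linear growth. -/
lemma IsLinLog.nonpos_of_binomExp_le {c p M : ℝ} {f : ℕ → ℝ} (hp0 : 0 < p) (hp1 : p < 1)
    (hf : IsLinLog c f) (hM : ∀ x, binomExp p x f ≤ M) : c ≤ 0 := by
  obtain ⟨K, hK, hf⟩ := hf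
  by_contra! hc
  have h1 : ∀ x : ℕ, c * (p * x) ≤ M + K * (1 + Real.log (x + 1)) := by
    intro x
    have h : binomExp p x (fun y => c * y - K * (1 + Real.log (x + 1))) ≤ binomExp p x f := by
      refine binomExp_mono hp0.le hp1.le fun k hk => ?_
      have h2 := (abs_le.1 (hf k)).1
      have hkx : (k : ℝ) ≤ x := by exact_mod_cast hk
      have h3 : Real.log ((k : ℝ) + 1) ≤ Real.log (x + 1) :=
        Real.log_le_log (by positivity) (by linarith)
      have := mul_le_mul_of_nonneg_left h3 hK
      linarith
    rw [binomExp_sub, binomExp_const_mul, binomExp_const, binomExp_natCast] at h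
    linarith [hM x]
  have hcp : 0 < c * p := mul_pos hc hp0
  set A := |M| + K + c * p with hA
  have hA0 : 0 ≤ A := by positivity
  obtain ⟨n, hn⟩ := exists_nat_gt ((A + 2 * K) / (c * p))
  have hn' : (A + 2 * K) < n * (c * p) := (div_lt_iff₀ hcp).1 hn
  have hnpos : 0 < n := by
    rcases Nat.eq_zero_or_pos n with rfl | h
    · simp at hn'; linarith
    · exact h
  have hn1 : (1 : ℝ) ≤ n := by exact_mod_cast hnpos
  -- With `x + 1 = n ^ 2` the logarithm is `2 log n ≤ 2 n`, so a quadratic in `n` would be bounded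
  -- by a linear term.
  have h2 := h1 (n ^ 2 - 1)
  rw [Nat.cast_sub (Nat.one_le_pow _ _ hnpos)] at h2
  push_cast at h2
  rw [sub_add_cancel, Real.log_pow] at h2
  have h3 : Real.log n ≤ n := (Real.log_le_sub_one_of_pos (by linarith)).trans (by linarith)
  push_cast at h2
  nlinarith [mul_le_mul_of_nonneg_left h3 hK, le_abs_self M, mul_nonneg hA0 (sub_nonneg.2 hn1)]

lemma exists_logWeight_le {p : ℝ} (hp0 : 0 < p) (hp1 : p < 1) :
    ∃ K : ℝ, 0 ≤ K ∧ ∀ y : ℕ, logWeight p y ≤ K * (1 + Real.log (y + 1)) := by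
  obtain ⟨c, hc⟩ := exists_isLinLog_gTrunc hp0 hp1
  have h := hc.sub (isLinLog_mul (Real.binEntropy p / p))
  have hc0 := h.nonpos_of_binomExp_le hp0 hp1 (binomExp_logWeight_le hp0 hp1)
  obtain ⟨K, hK, h⟩ := h
  refine ⟨K, hK, fun y => ?_⟩
  have h1 := (abs_le.1 (h y)).2
  have h2 := mul_nonpos_of_nonpos_of_nonneg hc0 (Nat.cast_nonneg (α := ℝ) y)
  rw [logWeight]
  linarith

/-- The weight of `y` before normalization. -/
noncomputable def weight (p q : ℝ) (y : ℕ) : ℝ := q ^ y * Real.exp (logWeight p y)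

lemma truncMass_eq (p q y₀ : ℝ) (y : ℕ) : truncMass p q y₀ y = y₀ * weight p q y := by
  have h : (y.factorial : ℝ) = Real.exp (Real.log y.factorial) :=
    (Real.exp_log (by positivity)).symm
  rw [truncMass, weight, logWeight, mul_div_assoc, h, Real.log_exp, ← Real.exp_sub]
  congr 3
  ring_nf

lemma weight_pos {p q : ℝ} (hq : 0 < q) (y : ℕ) : 0 < weight p q y := by
  unfold weight; positivity

lemma weight_zero (p q : ℝ) : weight p q 0 = 1 := by simp [weight, logWeight, gTrunc]

lemma summable_mul_weight {p q : ℝ} (hp0 : 0 < p) (hp1 : p < 1) (hq0 : 0 < q) (hq1 : q < 1) :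
    Summable (fun y : ℕ => ((y : ℝ) + 1) * weight p q y) := by
  obtain ⟨K, hK, h⟩ := exists_logWeight_le hp0 hp1
  -- An integer `N ≥ K` gives `exp (K (1 + log (y + 1))) ≤ e ^ N (y + 1) ^ N`.
  obtain ⟨N, hN⟩ := exists_nat_ge K
  have hg : Summable (fun y : ℕ => (y : ℝ) ^ (N + 1) * q ^ y) :=
    summable_pow_mul_geometric_of_norm_lt_one (N + 1) (by rwa [Real.norm_of_nonneg hq0.le])
  have hs := ((summable_nat_add_iff 1).2 hg).mul_left (Real.exp N / q)
  refine Summable.of_nonneg_of_le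
    (fun y => mul_nonneg (by positivity) (weight_pos hq0 y).le) (fun y => ?_) hs
  have h1 : Real.exp (logWeight p y) ≤ Real.exp N * ((y : ℝ) + 1) ^ N := by
    rw [← Real.exp_log (show (0 : ℝ) < ((y : ℝ) + 1) ^ N by positivity), ← Real.exp_add,
      Real.log_pow]
    refine Real.exp_le_exp.2 ((h y).trans ?_)
    nlinarith [log_natCast_add_one_nonneg y,
      mul_le_mul_of_nonneg_right hN (log_natCast_add_one_nonneg y)]
  calc ((y : ℝ) + 1) * weight p q y
      ≤ ((y : ℝ) + 1) * (q ^ y * (Real.exp N * ((y : ℝ) + 1) ^ N)) := by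
        rw [weight]; gcongr
    _ = _ := by
        rw [pow_succ q, pow_succ _ N, Nat.cast_add_one, div_mul_eq_mul_div, eq_div_iff hq0.ne']
        ring

/-! ### Divergences on the non-negative integers -/

/-- Replacing the output law by any other law increases the divergence that defines the mutual
information. -/
lemma mutualInfo_le_klDiv_prod (W : Kernel ℕ ℕ) [IsMarkovKernel W] (X Y : Measure ℕ)
    [IsProbabilityMeasure X] [IsProbabilityMeasure Y] :
    mutualInfo W X ≤ klDiv (X ⊗ₘ W) (X.prod Y) := by
  have hswap : (X ⊗ₘ W).map Prod.swap = (W ∘ₘ X) ⊗ₘ W†X := (compProd_posterior_eq_map_swap).symm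
  calc mutualInfo W X
      = klDiv (((X ⊗ₘ W).map Prod.swap).map Prod.swap)
          (((W ∘ₘ X).prod X).map Prod.swap) := by
        rw [mutualInfo, Measure.prod_swap, Measure.map_map measurable_swap measurable_swap]
        simp
    _ ≤ klDiv ((W ∘ₘ X) ⊗ₘ W†X) ((W ∘ₘ X) ⊗ₘ Kernel.const ℕ X) := by
        rw [hswap, Measure.compProd_const]
        exact klDiv_map_le _ _ measurable_swap
    _ ≤ klDiv ((W ∘ₘ X) ⊗ₘ W†X) (Y ⊗ₘ Kernel.const ℕ X) := by
        -- The chain rule splits off `D(W ∘ X ‖ Y) ≥ 0`, which is dropped; the swap was needed to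
        -- put the output first.
        rw [klDiv_compProd_eq_add (ν := Y)]
        exact le_add_self
    _ = klDiv ((X ⊗ₘ W).map Prod.swap) ((X.prod Y).map Prod.swap) := by
        rw [hswap, Measure.compProd_const, Measure.prod_swap]
    _ ≤ klDiv (X ⊗ₘ W) (X.prod Y) := klDiv_map_le _ _ measurable_swap

lemma rnDeriv_apply_of_singleton_ne_zero {α : Type*} [MeasurableSpace α]
    [MeasurableSingletonClass α] {μ ν : Measure α} [IsFiniteMeasure μ] [IsFiniteMeasure ν]
    (h : μ ≪ ν) {a : α} (ha : ν {a} ≠ 0) : μ.rnDeriv ν a = μ {a} / ν {a} := by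
  rw [← Measure.setLIntegral_rnDeriv h {a}, lintegral_singleton,
    ENNReal.mul_div_cancel_right ha (measure_ne_top _ _)]

lemma absolutelyContinuous_of_singleton_ne_zero {α : Type*} [MeasurableSpace α]
    (μ : Measure α) {ν : Measure α} (h : ∀ a, ν {a} ≠ 0) : μ ≪ ν := by
  intro s hs
  rcases s.eq_empty_or_nonempty with rfl | ⟨a, ha⟩
  · simp
  · exact absurd (measure_mono_null (Set.singleton_subset_iff.2 ha) hs) (h a)

/-- The mass of `X` cancels from the density at each atom. Writing the divergence through the
nonnegative `klFun` lets Tonelli apply, even for infinite values. -/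
lemma klDiv_compProd_prod (W : Kernel ℕ ℕ) [IsMarkovKernel W] (X Y : Measure ℕ)
    [IsProbabilityMeasure X] [IsProbabilityMeasure Y] (hY : ∀ y, Y {y} ≠ 0) :
    klDiv (X ⊗ₘ W) (X.prod Y) = ∫⁻ x, klDiv (W x) Y ∂X := by
  have hW : ∀ x, W x ≪ Y := fun x => absolutelyContinuous_of_singleton_ne_zero _ hY
  have hac : X ⊗ₘ W ≪ X.prod Y := by
    rw [← Measure.compProd_const]
    exact Measure.AbsolutelyContinuous.compProd_right (Filter.Eventually.of_forall hW)
  rw [klDiv_eq_lintegral_klFun_of_ac hac, lintegral_prod _ (by fun_prop), lintegral_countable',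
    lintegral_countable']
  refine tsum_congr fun x => ?_
  rcases eq_or_ne (X {x}) 0 with hx | hx
  · simp [hx]
  · rw [klDiv_eq_lintegral_klFun_of_ac (hW x)]
    congr 1
    refine lintegral_congr fun y => ?_
    have hxy : ({(x, y)} : Set (ℕ × ℕ)) = {x} ×ˢ {y} := by simp
    have hne : X.prod Y {(x, y)} ≠ 0 := by
      rw [hxy, Measure.prod_prod]
      exact mul_ne_zero hx (hY y)
    rw [rnDeriv_apply_of_singleton_ne_zero hac hne,
      rnDeriv_apply_of_singleton_ne_zero (hW x) (hY y), hxy, Measure.prod_prod,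
      Measure.compProd_apply_prod (measurableSet_singleton _) (measurableSet_singleton _),
      lintegral_singleton, mul_comm (W x {y}),
      ENNReal.mul_div_mul_left _ _ hx (measure_ne_top _ _)]

/-! ### The truncated distribution -/

lemma exists_normalizing_constant {p q : ℝ} (hp0 : 0 < p) (hp1 : p < 1) (hq0 : 0 < q)
    (hq1 : q < 1) :
    ∃ y₀ : ℝ, 0 < y₀ ∧ y₀ < 1 ∧ HasSum (truncMass p q y₀) 1 := by
  have hs : Summable (weight p q) :=
    (summable_mul_weight hp0 hp1 hq0 hq1).of_nonneg_of_le (fun y => (weight_pos hq0 y).le)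
      fun y => le_mul_of_one_le_left (weight_pos hq0 y).le
        (by linarith [Nat.cast_nonneg (α := ℝ) y])
  -- The weight at `0` is exactly `1` and the weight at `1` is positive, whence `y₀ < 1`.
  have h1 : 1 < ∑' y, weight p q y := by
    have := hs.sum_le_tsum (Finset.range 2) fun y _ => (weight_pos hq0 y).le
    rw [Finset.sum_range_succ, Finset.sum_range_one, weight_zero] at this
    linarith [weight_pos (p := p) hq0 1]
  refine ⟨(∑' y, weight p q y)⁻¹, by positivity, inv_lt_one_of_one_lt₀ h1, ?_⟩
  have h2 := hs.hasSum.mul_left (∑' y, weight p q y)⁻¹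
  rw [inv_mul_cancel₀ (by linarith)] at h2
  simpa only [← truncMass_eq] using h2

section Truncated

variable {p q y₀ : ℝ} {Y : Measure ℕ}

lemma normalizing_constant_pos [IsProbabilityMeasure Y]
    (hY : ∀ y : ℕ, Y.real {y} = truncMass p q y₀ y) : 0 < y₀ := by
  have h0 : Y.real {0} = y₀ := by rw [hY, truncMass_eq, weight_zero, mul_one]
  refine lt_of_le_of_ne (h0 ▸ measureReal_nonneg) fun h => ?_
  have h1 : Y = 0 := by
    refine Measure.ext_of_singleton fun y => ?_
    have := hY y
    rw [truncMass_eq, ← h, zero_mul, measureReal_eq_zero_iff] at this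
    simpa using this
  exact IsProbabilityMeasure.ne_zero Y h1

lemma normalizing_constant_le_one [IsProbabilityMeasure Y]
    (hY : ∀ y : ℕ, Y.real {y} = truncMass p q y₀ y) : y₀ ≤ 1 := by
  have h0 : Y.real {0} = y₀ := by rw [hY, truncMass_eq, weight_zero, mul_one]
  exact h0 ▸ measureReal_le_one

lemma truncated_singleton [IsProbabilityMeasure Y]
    (hY : ∀ y : ℕ, Y.real {y} = truncMass p q y₀ y) (y : ℕ) :
    Y {y} = ENNReal.ofReal (y₀ * weight p q y) := by
  rw [← truncMass_eq, ← hY, ofReal_measureReal]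

lemma truncated_singleton_ne_zero [IsProbabilityMeasure Y] (hq0 : 0 < q)
    (hY : ∀ y : ℕ, Y.real {y} = truncMass p q y₀ y) (y : ℕ) : Y {y} ≠ 0 := by
  rw [truncated_singleton hY, ne_eq, ENNReal.ofReal_eq_zero, not_le]
  exact mul_pos (normalizing_constant_pos hY) (weight_pos hq0 y)

lemma log_mul_weight (hq0 : 0 < q) (hy₀ : 0 < y₀) (k : ℕ) :
    Real.log (y₀ * weight p q k) = Real.log y₀ + Real.log q * k + logWeight p k := by
  rw [weight, Real.log_mul hy₀.ne' (by positivity), Real.log_mul (by positivity) (by positivity),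
    Real.log_pow, Real.log_exp]
  ring

theorem klDiv_binomial_truncated [IsProbabilityMeasure Y] (hp0 : 0 < p) (hp1 : p < 1)
    (hq0 : 0 < q) (hY : ∀ y : ℕ, Y.real {y} = truncMass p q y₀ y) (x : ℕ) :
    klDiv (binomial x ⟨p, hp0.le, hp1.le⟩) Y ≠ ∞ ∧
      (klDiv (binomial x ⟨p, hp0.le, hp1.le⟩) Y).toReal =
        -(p * x) * Real.log q - Real.log y₀ - kktGap p x := by
  have hY0 := truncated_singleton_ne_zero hq0 hY
  have hac := absolutelyContinuous_of_singleton_ne_zero (binomial x ⟨p, hp0.le, hp1.le⟩) hY0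
  have hy₀ := normalizing_constant_pos hY
  -- The binomial law has finite support, so the log-likelihood ratio is integrable.
  refine ⟨klDiv_ne_top hac (integrable_binomial _), ?_⟩
  rw [toReal_klDiv_of_measure_eq hac (by simp), integral_binomial, ← Nat.range_succ_eq_Iic]
  have h : ∑ k ∈ Finset.range (x + 1), ((x.choose k : ℝ) * p ^ k * (1 - p) ^ (x - k)) •
      llr (binomial x ⟨p, hp0.le, hp1.le⟩) Y k =
      binomExp p x (fun k => Real.log ((x.choose k : ℝ) * p ^ k * (1 - p) ^ (x - k))
        - (Real.log y₀ + Real.log q * k + logWeight p k)) := by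
    refine Finset.sum_congr rfl fun k hk => ?_
    have hkx : k ≤ x := Nat.lt_succ_iff.1 (Finset.mem_range.1 hk)
    have hmass : 0 < (x.choose k : ℝ) * p ^ k * (1 - p) ^ (x - k) := by
      have h1 : (0 : ℝ) < x.choose k := by exact_mod_cast Nat.choose_pos hkx
      have h2 : 0 < 1 - p := by linarith
      positivity
    rw [llr, rnDeriv_apply_of_singleton_ne_zero hac (hY0 k), ENNReal.toReal_div,
      ← measureReal_def, ← measureReal_def, hY, binomial_real_singleton, truncMass_eq,
      Real.log_div hmass.ne' (mul_pos hy₀ (weight_pos hq0 k)).ne', log_mul_weight hq0 hy₀,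
      smul_eq_mul]
  refine h.trans ?_
  have h2 : binomExp p x (fun k => logWeight p k) = _ := binomExp_logWeight hp0 hp1 x
  rw [binomExp_sub, binomExp_add, binomExp_add, binomExp_const, binomExp_const_mul,
    binomExp_natCast, h2]
  ring

lemma lintegral_truncated_ne_top [IsProbabilityMeasure Y] (hp0 : 0 < p) (hp1 : p < 1)
    (hq0 : 0 < q) (hq1 : q < 1) (hY : ∀ y : ℕ, Y.real {y} = truncMass p q y₀ y) :
    ∫⁻ y : ℕ, (y : ℝ≥0∞) ∂Y ≠ ∞ := by
  have hy₀ := normalizing_constant_pos hY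
  have hs : Summable (fun y : ℕ => (y : ℝ) * (y₀ * weight p q y)) := by
    refine Summable.of_nonneg_of_le
      (fun y => mul_nonneg (Nat.cast_nonneg y) (mul_pos hy₀ (weight_pos hq0 y)).le)
      (fun y => ?_) ((summable_mul_weight hp0 hp1 hq0 hq1).mul_left y₀)
    nlinarith [mul_pos hy₀ (weight_pos (p := p) hq0 y)]
  rw [lintegral_countable']
  convert hs.tsum_ofReal_ne_top using 3 with y
  rw [truncated_singleton hY, ENNReal.ofReal_mul (Nat.cast_nonneg y), ENNReal.ofReal_natCast]

lemma lintegral_truncated_ne_zero [IsProbabilityMeasure Y] (hq0 : 0 < q)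
    (hY : ∀ y : ℕ, Y.real {y} = truncMass p q y₀ y) :
    ∫⁻ y : ℕ, (y : ℝ≥0∞) ∂Y ≠ 0 := by
  rw [lintegral_countable', ne_eq, ENNReal.tsum_eq_zero, not_forall]
  exact ⟨1, by simpa using truncated_singleton_ne_zero hq0 hY 1⟩

instance (P : unitInterval) : IsMarkovKernel (binomialChannel P) :=
  ⟨fun x => inferInstanceAs (IsProbabilityMeasure (binomial x P))⟩

lemma lintegral_natCast_binomial (hp0 : 0 < p) (hp1 : p < 1) (x : ℕ) :
    ∫⁻ y : ℕ, (y : ℝ≥0∞) ∂(binomial x ⟨p, hp0.le, hp1.le⟩) = ENNReal.ofReal (p * x) := by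
  rw [← binomExp_natCast p x]
  have h := integral_binomial (n := x) (p := ⟨p, hp0.le, hp1.le⟩) (fun y : ℕ => (y : ℝ))
  rw [← Nat.range_succ_eq_Iic] at h
  have h' : ∫ y : ℕ, (y : ℝ) ∂(binomial x ⟨p, hp0.le, hp1.le⟩) =
    binomExp p x (fun k => (k : ℝ)) := h
  rw [← h', ofReal_integral_eq_lintegral_ofReal (integrable_binomial _)
    (Filter.Eventually.of_forall fun y => Nat.cast_nonneg y)]
  simp

theorem meanLimitedCapacity_le [IsProbabilityMeasure Y] (hp0 : 0 < p) (hp1 : p < 1)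
    (hq0 : 0 < q) (hq1 : q < 1) (hY : ∀ y : ℕ, Y.real {y} = truncMass p q y₀ y) (μ : ℝ≥0) :
    meanLimitedCapacity (binomialChannel ⟨p, hp0.le, hp1.le⟩) μ ≤
      ENNReal.ofReal (-(μ : ℝ) * Real.log q - Real.log y₀) := by
  refine iSup_le fun X => iSup_le fun hX => iSup_le fun hμ => ?_
  have hlq : 0 ≤ -Real.log q := by linarith [Real.log_nonpos hq0.le hq1.le]
  have hly : 0 ≤ -Real.log y₀ := by
    linarith [Real.log_nonpos (normalizing_constant_pos hY).le (normalizing_constant_le_one hY)]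
  have hmean : ∫⁻ x : ℕ, ENNReal.ofReal (p * x) ∂X = μ := by
    rw [← hμ, Measure.lintegral_bind (Kernel.aemeasurable _) (by fun_prop)]
    exact lintegral_congr fun x => (lintegral_natCast_binomial hp0 hp1 x).symm
  calc mutualInfo (binomialChannel ⟨p, hp0.le, hp1.le⟩) X
      ≤ klDiv (X ⊗ₘ binomialChannel ⟨p, hp0.le, hp1.le⟩) (X.prod Y) :=
        mutualInfo_le_klDiv_prod _ X Y
    _ = ∫⁻ x, klDiv (binomial x ⟨p, hp0.le, hp1.le⟩) Y ∂X :=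
        klDiv_compProd_prod _ X Y (truncated_singleton_ne_zero hq0 hY)
    _ ≤ ∫⁻ x : ℕ, (ENNReal.ofReal (-Real.log q) * ENNReal.ofReal (p * x)
          + ENNReal.ofReal (-Real.log y₀)) ∂X := by
        refine lintegral_mono fun x => ?_
        obtain ⟨h1, h2⟩ := klDiv_binomial_truncated hp0 hp1 hq0 hY x
        have hR := kktGap_nonneg hp0 hp1 (Nat.cast_nonneg (α := ℝ) x)
        rw [← ENNReal.ofReal_mul hlq, ← ENNReal.ofReal_add (by positivity) hly,
          ← ENNReal.ofReal_toReal h1, h2]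
        exact ENNReal.ofReal_le_ofReal (by linarith)
    _ = ENNReal.ofReal (-(μ : ℝ) * Real.log q - Real.log y₀) := by
        rw [lintegral_add_right _ measurable_const, lintegral_const_mul _ (by fun_prop), hmean,
          lintegral_const, measure_univ, mul_one, ← ENNReal.ofReal_coe_nnreal,
          ← ENNReal.ofReal_mul hlq, ← ENNReal.ofReal_add (by positivity) hly]
        congr 1
        ring

end Truncated

end BinomialCapacity

theorem mainTheorem6 (p : ℝ) (hp0 : 0 < p) (hp1 : p < 1) :
    -- the gap is non-negative and decays exponentially
    (∀ x : ℝ, 0 ≤ x → 0 ≤ BinomialCapacity.kktGap p x) ∧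
    (∃ C r : ℝ, 0 < C ∧ 0 < r ∧ r < 1 ∧
      ∀ x : ℝ, 0 ≤ x → BinomialCapacity.kktGap p x ≤ C * r ^ x) ∧
    ∀ q : ℝ, 0 < q → q < 1 →
      -- the weights can be normalized
      (∃ y₀ : ℝ, 0 < y₀ ∧ y₀ < 1 ∧ HasSum (BinomialCapacity.truncMass p q y₀) 1) ∧
      ∀ (y₀ : ℝ) (Y : Measure ℕ), IsProbabilityMeasure Y →
        (∀ y : ℕ, Y.real {y} = BinomialCapacity.truncMass p q y₀ y) →
        -- the divergence from the binomial laws is linear up to the gap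
        (∀ x : ℕ, klDiv (binomial x ⟨p, hp0.le, hp1.le⟩) Y ≠ ∞ ∧
          (klDiv (binomial x ⟨p, hp0.le, hp1.le⟩) Y).toReal =
            -(p * x) * Real.log q - Real.log y₀ - BinomialCapacity.kktGap p x) ∧
        -- the mean is finite and positive, and the capacity bound holds
        ∃ μ : ℝ≥0, 0 < μ ∧ ∫⁻ y : ℕ, (y : ℝ≥0∞) ∂Y = (μ : ℝ≥0∞) ∧
          BinomialCapacity.meanLimitedCapacity
              (BinomialCapacity.binomialChannel ⟨p, hp0.le, hp1.le⟩) μ ≤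
            ENNReal.ofReal (-(μ : ℝ) * Real.log q - Real.log y₀) := by
  refine ⟨fun x hx => BinomialCapacity.kktGap_nonneg hp0 hp1 hx,
    ⟨1 / p ^ 2, 1 - p, by positivity, by linarith, by linarith,
      fun x hx => BinomialCapacity.kktGap_le hp0 hp1 hx⟩,
    fun q hq0 hq1 => ⟨BinomialCapacity.exists_normalizing_constant hp0 hp1 hq0 hq1,
      fun y₀ Y hYp hY => ⟨BinomialCapacity.klDiv_binomial_truncated hp0 hp1 hq0 hY, ?_⟩⟩⟩
  have htop := BinomialCapacity.lintegral_truncated_ne_top hp0 hp1 hq0 hq1 hY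
  have hne := BinomialCapacity.lintegral_truncated_ne_zero hq0 hY
  exact ⟨(∫⁻ y : ℕ, (y : ℝ≥0∞) ∂Y).toNNReal, ENNReal.toNNReal_pos hne htop,
    (ENNReal.coe_toNNReal htop).symm,
    BinomialCapacity.meanLimitedCapacity_le hp0 hp1 hq0 hq1 hY _⟩
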